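/- There exists an infinite, countably compact Tychonoff space $X$ such that $C_p(X,[0,1])$ is a Baire space. Here a Tychonoff space is a completely regular $T_1$-space; $X$ is countably compact if every countable open cover of $X$ has a finite subcover; $C_p(X,[0,1])$ is the set of all continuous functions $X\to[0,1]$ with the topology of pointwise convergence (the subspace topology from the product $[0,1]^X$); and a topological space is Baire if the intersection of every sequence of dense open subsets is dense. -/

import Mathlib

/-- The function space `C_p(X, Y)`: all continuous maps from `X` to `Y`, with the topology of
pointwise convergence, that is, the subspace topology inherited from the product `X → Y`. -/
abbrev Cp (X Y : Type*) [TopologicalSpace X] [TopologicalSpace Y] : Type _ :=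
  {f : X → Y // Continuous f}

/-! The points form a tree: every double sequence `f` of points gives a point `lim f`, and an
injective `f` is made to converge to `lim f` along a free ultrafilter. This forces countable
compactness. The topology is induced by the coherent functions, so continuity is coherence
(`continuous_iff_coherent`).

Baireness is a fusion argument (`exists_coherent_of_robust`): dense open sets are entered stage by
stage on a countable set closed under `kids`, while new children copy the value of their parent.
Parents must not compete for a child: the ultrafilters of distinct points make countably many
sequences disjoint on large sets (`exists_ultrafilter_family`). Children added while a dense open
set is being entered cannot copy: such stages are made negligible by `exists_negligible_stages`. All
finite sets and tolerances must be fixed before any values are; compactness of `[0,1]^F` allows this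
(`exists_robust_extension`). -/

open Set Filter Topology

/-! ### Almost disjoint sets and block filters -/

/-- There is an almost disjoint family of infinite subsets of `ℕ` indexed by `ℕ → Bool`. -/
theorem exists_almostDisjoint_family :
    ∃ a : (ℕ → Bool) → Set ℕ, (∀ x, (a x).Infinite) ∧ ∀ x y, x ≠ y → (a x ∩ a y).Finite := by
  let e : (ℕ → Bool) → ℕ → ℕ := fun x n => Encodable.encode (List.ofFn fun i : Fin n => x i)
  have key : ∀ x y m n, e x m = e y n → m = n ∧ ∀ i < n, x i = y i := by
    intro x y m n h
    have h := Encodable.encode_injective h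
    have hl : m = n := by simpa using congrArg List.length h
    subst hl
    refine ⟨rfl, fun i hi => ?_⟩
    exact congrFun (List.ofFn_injective h) ⟨i, hi⟩
  refine ⟨fun x => range (e x), fun x => infinite_range_of_injective fun m n h => (key x x m n h).1,
    fun x y hxy => ?_⟩
  obtain ⟨k, hk⟩ := Function.ne_iff.1 hxy
  refine ((finite_Iic k).image (e x)).subset ?_
  rintro _ ⟨⟨m, rfl⟩, n, hn⟩
  obtain ⟨rfl, h⟩ := key _ _ _ _ hn
  refine ⟨n, ?_, rfl⟩
  by_contra hc
  exact hk (h k (not_le.1 hc)).symm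

/-- Total size (plus one) of the first `n` blocks. -/
def blockSum : ℕ → ℕ
  | 0 => 1
  | n + 1 => blockSum n + (n + 1) ^ 2 * blockSum n

/-- Size of the `n`-th block. -/
def blockSize (n : ℕ) : ℕ := (n + 1) ^ 2 * blockSum n

/-- The number of points of the `n`-th block that count as few. -/
def smallSize (n : ℕ) : ℕ := (n + 1) * blockSum n

theorem blockSum_pos (n : ℕ) : 0 < blockSum n := by
  induction n with
  | zero => simp [blockSum]
  | succ n ih => rw [blockSum]; omega

theorem sum_blockSize_lt (n : ℕ) : ∑ m ∈ Finset.range n, blockSize m < blockSum n := by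
  induction n with
  | zero => simp [blockSum]
  | succ n ih => rw [Finset.sum_range_succ, blockSum, blockSize]; omega

open Classical in
/-- The points of the `n`-th block outside `U`. -/
noncomputable def blockMissing (U : Set (ℕ × ℕ)) (n : ℕ) : Finset ℕ :=
  (Finset.range (blockSize n)).filter fun j => (n, j) ∉ U

theorem mem_blockMissing {U : Set (ℕ × ℕ)} {n j : ℕ} :
    j ∈ blockMissing U n ↔ j < blockSize n ∧ (n, j) ∉ U := by
  simp [blockMissing]

/-- The filter of the sets that contain all but few points of almost every block indexed by `a`,
and that contain almost all these blocks only. -/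
noncomputable def blockFilter (a : Set ℕ) : Filter (ℕ × ℕ) where
  sets := {U | ∃ c, ∀ᶠ n in atTop, n ∈ a → (blockMissing U n).card ≤ c * smallSize n}
  univ_sets := ⟨0, by simp [blockMissing]⟩
  sets_of_superset := by
    rintro U V ⟨c, hc⟩ hUV
    refine ⟨c, hc.mono fun n hn ha => (Finset.card_le_card ?_).trans (hn ha)⟩
    intro j hj
    simp only [mem_blockMissing] at hj ⊢
    exact ⟨hj.1, fun h => hj.2 (hUV h)⟩
  inter_sets := by
    rintro U V ⟨c, hc⟩ ⟨d, hd⟩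
    refine ⟨c + d, (hc.and hd).mono fun n hn ha => ?_⟩
    have hsub : blockMissing (U ∩ V) n ⊆ blockMissing U n ∪ blockMissing V n := by
      intro j hj
      simp only [mem_blockMissing, Finset.mem_union, mem_inter_iff] at hj ⊢
      tauto
    rw [add_mul]
    exact (Finset.card_le_card hsub).trans ((Finset.card_union_le _ _).trans
      (add_le_add (hn.1 ha) (hn.2 ha)))

theorem mem_blockFilter {a : Set ℕ} {U : Set (ℕ × ℕ)} : U ∈ blockFilter a ↔
    ∃ c, ∀ᶠ n in atTop, n ∈ a → (blockMissing U n).card ≤ c * smallSize n := Iff.rfl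

/-- A block exceeds `smallSize n` by the unbounded factor `n + 1`. -/
theorem blockFilter_neBot {a : Set ℕ} (ha : a.Infinite) : (blockFilter a).NeBot := by
  rw [neBot_iff, Ne, ← empty_mem_iff_bot, mem_blockFilter]
  rintro ⟨c, hc⟩
  obtain ⟨n, hna, hn, hcn⟩ := ((Nat.frequently_atTop_iff_infinite.2 ha).and_eventually
    (hc.and (eventually_ge_atTop c))).exists
  have h := hn hna
  simp only [blockMissing, mem_empty_iff_false, not_false_eq_true, Finset.filter_true,
    Finset.card_range, blockSize, smallSize] at h
  have := blockSum_pos n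
  have : c * ((n + 1) * blockSum n) < (n + 1) ^ 2 * blockSum n := by
    rw [pow_two, mul_assoc]
    exact Nat.mul_lt_mul_of_pos_right (by omega) (by positivity)
  omega

theorem blockFilter_le_cofinite (a : Set ℕ) : blockFilter a ≤ cofinite := by
  refine le_cofinite_iff_compl_singleton_mem.2 fun p => mem_blockFilter.2 ⟨0, ?_⟩
  filter_upwards [eventually_gt_atTop p.1] with n hn _
  rw [Nat.zero_mul, Nat.le_zero, Finset.card_eq_zero, blockMissing]
  refine Finset.eq_empty_of_forall_notMem fun j hj => ?_
  have h : (n, j) = p := not_not.1 (mem_blockMissing.1 hj).2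
  rw [← h] at hn
  exact lt_irrefl _ hn

/-- The points of the blocks before the `n`-th one. -/
def earlierBlocks (n : ℕ) : Finset (Σ _ : ℕ, ℕ) :=
  (Finset.range n).sigma fun m => Finset.range (blockSize m)

theorem card_earlierBlocks_lt (n : ℕ) : (earlierBlocks n).card < blockSum n := by
  simpa [earlierBlocks, Finset.card_sigma] using sum_blockSize_lt n

open Classical in
-- `U i` omits the points of block `n` whose image is already taken in an earlier block by one of
-- the at most `n + 1` sequences with code up to `n`. There are at most `(n + 1) * blockSum n` such
-- images, which is `smallSize n`. Almost disjointness excludes collisions within one block at the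
-- cost of finitely many blocks.
theorem exists_disjoint_images {ι X : Type*} [Countable ι] (a : ι → Set ℕ)
    (ha : ∀ i j, i ≠ j → (a i ∩ a j).Finite) (f : ι → ℕ × ℕ → X) :
    ∃ U : ι → Set (ℕ × ℕ), (∀ i, Function.Injective (f i) → U i ∈ blockFilter (a i)) ∧
      ∀ i j, i ≠ j → Disjoint (f i '' U i) (f j '' U j) := by
  obtain ⟨ν, hν⟩ := exists_injective_nat ι
  let bad : ℕ → Set X := fun n => {w | ∃ l m k, ν l ≤ n ∧ m < n ∧ k < blockSize m ∧ f l (m, k) = w}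
  let U : ι → Set (ℕ × ℕ) := fun i => {p | p.1 ∈ a i ∧ p.2 < blockSize p.1 ∧ ν i ≤ p.1 ∧
    (∀ l, ν l < ν i → p.1 ∉ a l) ∧ f i p ∉ bad p.1}
  refine ⟨U, fun i hi => mem_blockFilter.2 ⟨1, ?_⟩, fun i j hij => ?_⟩
  · have hfin : (⋃ l ∈ {l | ν l < ν i}, a i ∩ a l).Finite := by
      refine Set.Finite.biUnion ((finite_Iio (ν i)).preimage hν.injOn) fun l hl => ha _ _ ?_
      rintro rfl
      exact lt_irrefl (ν i) hl
    have hev : ∀ᶠ n in atTop, n ∉ ⋃ l ∈ {l | ν l < ν i}, a i ∩ a l := by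
      rw [← Nat.cofinite_eq_atTop]; exact hfin.compl_mem_cofinite
    filter_upwards [hev, eventually_ge_atTop (ν i)] with n hn hin hna
    rw [one_mul]
    have hbad : ∃ B : Finset X, B.card ≤ smallSize n ∧ ∀ w ∈ bad n, w ∈ B := by
      -- The default `f i (0, 0)` serves only codes that `ν` does not attain.
      refine ⟨((Finset.range (n + 1)) ×ˢ earlierBlocks n).image fun q =>
        if h : ∃ l, ν l = q.1 then f h.choose (q.2.1, q.2.2) else f i (0, 0), ?_, ?_⟩
      · refine Finset.card_image_le.trans ?_
        rw [Finset.card_product, Finset.card_range, smallSize]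
        exact Nat.mul_le_mul_left _ (card_earlierBlocks_lt n).le
      · rintro w ⟨l, m, k, hl, hm, hk, rfl⟩
        refine Finset.mem_image.2 ⟨(ν l, ⟨m, k⟩), ?_, ?_⟩
        · simp [earlierBlocks, hm, hk]; omega
        · have h : ∃ l', ν l' = ν l := ⟨l, rfl⟩
          rw [dif_pos h, hν h.choose_spec]
    obtain ⟨B, hBc, hB⟩ := hbad
    refine (Finset.card_le_card_of_injOn (fun j => f i (n, j)) ?_ ?_).trans hBc
    · intro j hj
      have hj := mem_blockMissing.1 hj
      apply hB
      by_contra hc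
      refine hj.2 ⟨hna, hj.1, hin, fun l hl hal => hn ?_, hc⟩
      exact mem_biUnion (show l ∈ {l | ν l < ν i} from hl) ⟨hna, hal⟩
    · intro j _ j' _ h
      exact (Prod.mk.inj (hi h)).2
  · rw [Set.disjoint_left]
    rintro w ⟨⟨n, k⟩, ⟨h1, h2, h3, h4, h5⟩, rfl⟩ ⟨⟨n', k'⟩, ⟨h1', h2', h3', h4', h5'⟩, hw⟩
    dsimp only at *
    rcases lt_trichotomy n n' with hlt | rfl | hlt
    · exact h5' ⟨i, n, k, h3.trans hlt.le, hlt, h2, hw.symm⟩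
    · rcases lt_or_gt_of_ne (hν.ne hij) with h | h
      · exact h4' i h h1
      · exact h4 j h h1'
    · exact h5 ⟨j, n', k', h3'.trans hlt.le, hlt, h2', hw⟩

/-- A family of free ultrafilters such that any countably many injective sequences, equipped with
different ultrafilters of the family, become disjoint on suitable large sets. -/
theorem exists_ultrafilter_family : ∃ p : (ℕ → Bool) → Ultrafilter (ℕ × ℕ),
    (∀ x, (p x : Filter (ℕ × ℕ)) ≤ cofinite) ∧
    ∀ (ι X : Type) [Countable ι] (x : ι → ℕ → Bool) (f : ι → ℕ × ℕ → X), Function.Injective x →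
      ∃ U : ι → Set (ℕ × ℕ), (∀ i, Function.Injective (f i) → U i ∈ p (x i)) ∧
        ∀ i j, i ≠ j → Disjoint (f i '' U i) (f j '' U j) := by
  obtain ⟨a, hinf, had⟩ := exists_almostDisjoint_family
  have hne := fun x => blockFilter_neBot (hinf x)
  refine ⟨fun x => Ultrafilter.of (blockFilter (a x)),
    fun x => (Ultrafilter.of_le _).trans (blockFilter_le_cofinite _), ?_⟩
  intro ι X _ x f hx
  obtain ⟨U, hU, hd⟩ := exists_disjoint_images (fun i => a (x i))
    (fun i j hij => had _ _ (hx.ne hij)) f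
  exact ⟨U, fun i hi => Ultrafilter.of_le _ (hU i hi), hd⟩

/-! ### The tree of points -/

/-- The points of the space: `leaf n` is unconstrained, and `lim f` is to become a limit of the
double sequence `f`. -/
inductive SeqTree : Type
  | leaf (n : ℕ) : SeqTree
  | lim (f : ℕ × ℕ → SeqTree) : SeqTree

namespace SeqTree

/-- The arities of the constructors of `SeqTree`, as a `W`-type. -/
def Arity : Option ℕ → Type
  | none => ℕ × ℕ
  | some _ => Empty

/-- The embedding of `SeqTree` into a `W`-type. -/
def toW : SeqTree → WType Arity
  | leaf n => WType.mk (some n) Empty.elim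
  | lim f => WType.mk none fun s => toW (f s)

theorem toW_injective : Function.Injective toW := by
  intro s
  induction s with
  | leaf n =>
    intro t h
    cases t with
    | leaf m => injection h with h _; injection h with h; rw [h]
    | lim g => injection h with h _; cases h
  | lim f ih =>
    intro t h
    cases t with
    | leaf m => injection h with h _; cases h
    | lim g =>
      injection h with _ h
      congr 1
      funext s
      exact ih s (congrFun h s)

/-- All arities are countable, and continuum to the power `ℵ₀` is continuum. -/
theorem exists_code : ∃ c : SeqTree → ℕ → Bool, Function.Injective c := by
  have hW : Cardinal.mk (WType Arity) ≤ Cardinal.continuum := by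
    refine WType.cardinalMk_le_of_le ?_
    refine (Cardinal.sum_le_mk_mul_iSup _).trans ?_
    refine (mul_le_mul' Cardinal.mk_le_aleph0 (ciSup_le' (a := Cardinal.continuum) ?_)).trans
      Cardinal.aleph0_mul_continuum.le
    rintro (_ | n)
    · simp [Arity]
    · simp [Arity, Cardinal.one_le_iff_pos, Cardinal.continuum_pos]
  have h : Cardinal.mk SeqTree ≤ Cardinal.mk (ℕ → Bool) := by
    refine (Cardinal.mk_le_of_injective toW_injective).trans (hW.trans ?_)
    simp
  obtain ⟨e⟩ := h
  exact ⟨e, e.injective⟩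

end SeqTree

/-! ### Coherent functions -/

namespace SeqTree

/-- The free ultrafilter that decides to which points the sequence of `t` converges. -/
noncomputable def ultra (t : SeqTree) : Ultrafilter (ℕ × ℕ) :=
  exists_ultrafilter_family.choose (exists_code.choose t)

theorem ultra_le_cofinite (t : SeqTree) : (ultra t : Filter (ℕ × ℕ)) ≤ cofinite :=
  exists_ultrafilter_family.choose_spec.1 _

theorem exists_disjoint_images_ultra {ι X : Type} [Countable ι] (t : ι → SeqTree)
    (ht : Function.Injective t) (f : ι → ℕ × ℕ → X) :
    ∃ U : ι → Set (ℕ × ℕ), (∀ i, Function.Injective (f i) → U i ∈ ultra (t i)) ∧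
      ∀ i j, i ≠ j → Disjoint (f i '' U i) (f j '' U j) :=
  exists_ultrafilter_family.choose_spec.2 ι X (fun i => exists_code.choose (t i)) f
    (exists_code.choose_spec.comp ht)

/-- The double sequence attached to a point. -/
def kids : SeqTree → ℕ × ℕ → SeqTree
  | leaf n => fun _ => leaf n
  | lim f => f

/-- A function is coherent if its value at every point with an injective sequence is the limit of
its values along this sequence, with respect to the ultrafilter of the point. -/
def Coherent (φ : SeqTree → unitInterval) : Prop :=
  ∀ t, Function.Injective (kids t) → Tendsto (fun s => φ (kids t s)) (ultra t) (𝓝 (φ t))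

open Classical in
/-- The coherent function that is given by `φ` on `Y` and on the leaves. -/
noncomputable def cohExt (Y : Set SeqTree) (φ : SeqTree → unitInterval) : SeqTree → unitInterval
  | leaf n => φ (leaf n)
  | lim f => if lim f ∈ Y then φ (lim f) else
      limUnder (ultra (lim f) : Filter (ℕ × ℕ)) fun s => cohExt Y φ (f s)

theorem cohExt_of_mem {Y : Set SeqTree} (φ : SeqTree → unitInterval) {t : SeqTree} (ht : t ∈ Y) :
    cohExt Y φ t = φ t := by
  cases t with
  | leaf n => rw [cohExt]
  | lim f => rw [cohExt, if_pos ht]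

theorem exists_coherent_extension {Y : Set SeqTree} (hY : ∀ t ∈ Y, ∀ s, kids t s ∈ Y)
    (φ : SeqTree → unitInterval)
    (hφ : ∀ t ∈ Y, Function.Injective (kids t) →
      Tendsto (fun s => φ (kids t s)) (ultra t) (𝓝 (φ t))) :
    ∃ ψ, Coherent ψ ∧ ∀ t ∈ Y, ψ t = φ t := by
  refine ⟨cohExt Y φ, fun t ht => ?_, fun t => cohExt_of_mem φ⟩
  by_cases htY : t ∈ Y
  · simpa only [cohExt_of_mem φ htY, cohExt_of_mem φ (hY t htY _)] using hφ t htY ht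
  · cases t with
    | leaf n =>
      -- The sequence of a leaf is constant, hence not injective.
      have h := @ht (0, 0) (0, 1) rfl
      simp at h
    | lim f =>
      have h := ((ultra (lim f)).map fun s => cohExt Y φ (f s)).le_nhds_lim
      rw [cohExt, if_neg htY]
      exact h

end SeqTree

/-! ### Propagation and limits -/

theorem exists_propagated {X Z : Type*} (r : X → ℕ) (P : X → X → Prop)
    (huniq : ∀ z y y', P z y → P z y' → y = y') (hdec : ∀ z y, P z y → r y < r z)
    (S : Set X) (v : X → Z) :
    ∃ h : X → Z, (∀ z ∈ S, h z = v z) ∧ ∀ z, z ∉ S → ∀ y, P z y → h z = h y := by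
  classical
  have wf : WellFounded fun y z : X => r y < r z := (measure r).wf
  let step : (z : X) → ((y : X) → r y < r z → Z) → Z := fun z rec =>
    if z ∈ S then v z else if h : ∃ y, P z y then rec h.choose (hdec z _ h.choose_spec) else v z
  refine ⟨wf.fix step, fun z hz => ?_, fun z hz y hy => ?_⟩
  · rw [wf.fix_eq]
    simp only [step, if_pos hz]
  · rw [wf.fix_eq]
    have h : ∃ y, P z y := ⟨y, hy⟩
    simp only [step, if_neg hz, dif_pos h]
    rw [huniq z _ _ h.choose_spec hy]

/-- Iterating the operators `st n`, `n ∈ A`, each followed by propagation along the parent relation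
`P`, and passing to the limit. -/
theorem exists_limit_of_steps {X Z : Type*} [MetricSpace Z] [CompactSpace Z]
    (F : ℕ → Set X) (hF : Monotone F) (ε : ℕ → ℝ)
    (hε : ∀ n, ε (n + 1) ≤ ε n / 2) (hε0 : ∀ n, 0 < ε n)
    (r : X → ℕ) (P : X → X → Prop) (huniq : ∀ z y y', P z y → P z y' → y = y')
    (hdec : ∀ z y, P z y → r y < r z) (hPF : ∀ z y n, P z y → z ∈ F (n + 1) → y ∈ F n)
    (st : ℕ → (X → Z) → X → Z) (hst : ∀ n v, ∀ z ∈ F n, dist (st n v z) (v z) ≤ ε n)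
    (A : Set ℕ) (v : X → Z) :
    ∃ φ : X → Z, (∀ z ∈ F 0, dist (φ z) (v z) ≤ 2 * ε 0) ∧
      (∀ n ∈ A, ∃ u, ∀ z ∈ F (n + 1), dist (φ z) (st n u z) ≤ 2 * ε (n + 1)) ∧
      ∀ z y n, P z y → z ∈ F (n + 1) → z ∉ F n → n ∉ A → dist (φ z) (φ y) ≤ 4 * ε (n + 1) := by
  classical
  choose E hE1 hE2 using exists_propagated (Z := Z) r P huniq hdec
  let h : ℕ → X → Z := fun n => Nat.rec (E (F 0) v)
    (fun n u => if n ∈ A then E (F (n + 1)) (st n u) else u) n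
  have h0 : h 0 = E (F 0) v := rfl
  have hA : ∀ n ∈ A, h (n + 1) = E (F (n + 1)) (st n (h n)) := fun n hn => if_pos hn
  have hnA : ∀ n, n ∉ A → h (n + 1) = h n := fun n hn => if_neg hn
  have ha : ∀ n, ∀ z ∈ F n, dist (h (n + 1) z) (h n z) ≤ ε n := by
    intro n z hz
    by_cases hn : n ∈ A
    · rw [hA n hn, hE1 _ _ z (hF n.le_succ hz)]
      exact hst n _ z hz
    · rw [hnA n hn, dist_self]
      exact (hε0 n).le
  have hb : ∀ n z y, z ∉ F n → P z y → h n z = h n y := by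
    intro n
    induction n with
    | zero => intro z y hz hP; exact hE2 _ _ z hz y hP
    | succ n ih =>
      intro z y hz hP
      by_cases hn : n ∈ A
      · rw [hA n hn]; exact hE2 _ _ z hz y hP
      · rw [hnA n hn]; exact ih z y (fun h => hz (hF n.le_succ h)) hP
  -- Telescoping: halving gives `ε n ≤ 2 * ε n - 2 * ε (n + 1)`.
  have hc : ∀ n k, ∀ z ∈ F n, dist (h (n + k) z) (h n z) ≤ 2 * ε n - 2 * ε (n + k) := by
    intro n k z hz
    induction k with
    | zero => simp
    | succ k ih =>
      have h1 := ha (n + k) z (hF (Nat.le_add_right n k) hz)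
      have h2 := hε (n + k)
      have h3 := dist_triangle (h (n + k + 1) z) (h (n + k) z) (h n z)
      rw [← add_assoc]
      linarith
  -- Off the union of the `F n` the values need not converge, so an ultrafilter limit is taken.
  choose φ hφ using fun z => (isCompact_univ.ultrafilter_le_nhds
    ((hyperfilter ℕ).map fun n => h n z) (by simp))
  have hlim : ∀ z, Tendsto (fun n => h n z) (hyperfilter ℕ : Filter ℕ) (𝓝 (φ z)) := fun z =>
    (hφ z).2
  have hd : ∀ n, ∀ z ∈ F n, dist (φ z) (h n z) ≤ 2 * ε n := by
    intro n z hz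
    refine le_of_tendsto ((hlim z).dist tendsto_const_nhds) ?_
    have : ∀ᶠ m in atTop, dist (h m z) (h n z) ≤ 2 * ε n := by
      filter_upwards [eventually_ge_atTop n] with m hm
      obtain ⟨k, rfl⟩ := Nat.exists_eq_add_of_le hm
      have := hc n k z hz
      have := hε0 (n + k)
      linarith
    exact Nat.hyperfilter_le_atTop this
  refine ⟨φ, fun z hz => ?_, fun n hn => ⟨h n, fun z hz => ?_⟩, fun z y n hP hz hz' hn => ?_⟩
  · rw [← hE1 (F 0) v z hz]; exact hd 0 z hz
  · rw [← hE1 (F (n + 1)) (st n (h n)) z hz, ← hA n hn]; exact hd _ z hz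
  · have h1 := hd (n + 1) z hz
    have h2 := hd (n + 1) y (hF n.le_succ (hPF z y n hP hz))
    rw [hnA n hn] at h1 h2
    rw [hb n z y hz' hP] at h1
    have h3 := dist_triangle_right (φ z) (φ y) (h n y)
    linarith

namespace SeqTree

/-- There is an infinite set of stages such that the points added at these stages are negligible
for the ultrafilters of all points of `Y`. -/
theorem exists_negligible_stages (F : ℕ → Finset SeqTree) (hF : Monotone F) {Y : Set SeqTree}
    (hY : Y.Countable) :
    ∃ A : Set ℕ, A.Infinite ∧ ∀ y ∈ Y, Function.Injective (kids y) →
      {s | ∃ n ∈ A, kids y s ∈ F (n + 1) ∧ kids y s ∉ F n} ∉ ultra y := by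
  obtain ⟨a, hinf, had⟩ := exists_almostDisjoint_family
  by_contra! hcon
  choose y hyY hyi hy using fun x => hcon (a x) (hinf x)
  -- One point cannot defeat two index sets: their finitely many common stages add finitely many
  -- points, and the ultrafilter is free. So continuum many failures would inject into `Y`.
  have hinj : Function.Injective y := by
    intro x x' hxx
    by_contra hne
    have h1 := hy x
    have h2 := hy x'
    rw [← hxx] at h2
    refine (ultra (y x)).empty_notMem ?_
    have hfin : (kids (y x) ⁻¹' (⋃ n ∈ a x ∩ a x', (F (n + 1) : Set SeqTree))).Finite :=
      ((had x x' hne).biUnion fun n _ => (F (n + 1)).finite_toSet).preimage (hyi x).injOn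
    have h3 := ultra_le_cofinite (y x) hfin.compl_mem_cofinite
    filter_upwards [h1, h2, h3] with s hs1 hs2 hs3
    obtain ⟨n, hn, hn1, hn2⟩ := hs1
    obtain ⟨m, hm, hm1, hm2⟩ := hs2
    have hnm : n = m := by
      rcases lt_trichotomy n m with h | h | h
      · exact absurd (hF h hn1) hm2
      · exact h
      · exact absurd (hF h hm1) hn2
    subst hnm
    exact hs3 (mem_biUnion (show n ∈ a x ∩ a x' from ⟨hn, hm⟩) hn1)
  have hmk : Cardinal.mk (ℕ → Bool) = Cardinal.continuum := by simp
  have hcount : Countable (ℕ → Bool) := by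
    have := hY.to_subtype
    exact Function.Injective.countable (f := fun x => (⟨y x, hyY x⟩ : Y))
      fun x x' h => hinj (congrArg Subtype.val h)
  have hle : Cardinal.mk (ℕ → Bool) ≤ Cardinal.aleph0 := Cardinal.mk_le_aleph0
  exact Cardinal.aleph0_lt_continuum.not_ge (hmk ▸ hle)

end SeqTree

/-! ### The category argument -/

namespace SeqTree

/-- The category argument: if every `G n` contains, for suitable data on a finite set, all coherent
functions that obey these data up to a uniform error, then some coherent function belongs to all
`G n`. -/
theorem exists_coherent_of_robust (G : ℕ → Set (SeqTree → unitInterval)) (hanti : Antitone G)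
    (hG : ∀ n (F : Finset SeqTree) (ε : {ε : ℝ // 0 < ε}), ∃ F' : Finset SeqTree, ∃ δ : {δ : ℝ // 0 < δ},
      ∀ v : SeqTree → unitInterval, ∃ h : SeqTree → unitInterval,
        (∀ x ∈ F, dist (h x) (v x) ≤ ε) ∧
        ∀ g, Coherent g → (∀ x ∈ F', dist (g x) (h x) ≤ δ) → g ∈ G n)
    (v : SeqTree → unitInterval) (F₀ : Finset SeqTree) {ε₀ : ℝ} (hε₀ : 0 < ε₀) :
    ∃ φ, Coherent φ ∧ (∀ n, φ ∈ G n) ∧ ∀ x ∈ F₀, dist (φ x) (v x) ≤ ε₀ := by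
  classical
  choose F' δ st hst hstG using hG
  -- Both `ε₀` and `δ` are halved because passing to the limit doubles the error.
  let σ : ℕ → Finset SeqTree × {ε : ℝ // 0 < ε} := fun n => Nat.rec (F₀, ⟨ε₀ / 2, half_pos hε₀⟩)
    (fun n q => (F' n q.1 q.2 ∪ (q.1 ∪ (q.1 ×ˢ Finset.range (n + 1)).image
        fun w => kids w.1 (Nat.unpair w.2)),
      ⟨min (q.2 / 2) (δ n q.1 q.2 / 2), lt_min (half_pos q.2.2) (half_pos (δ n q.1 q.2).2)⟩)) n
  let F : ℕ → Finset SeqTree := fun n => (σ n).1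
  let ε : ℕ → ℝ := fun n => (σ n).2
  have hε0 : ∀ n, 0 < ε n := fun n => (σ n).2.2
  have hFs : ∀ n, F (n + 1) = F' n (F n) (σ n).2 ∪ (F n ∪ (F n ×ˢ Finset.range (n + 1)).image
      fun w => kids w.1 (Nat.unpair w.2)) := fun n => rfl
  have hεs : ∀ n, ε (n + 1) = min (ε n / 2) (δ n (F n) (σ n).2 / 2) := fun n => rfl
  have hε : ∀ n, ε (n + 1) ≤ ε n / 2 := fun n => (hεs n).trans_le (min_le_left _ _)
  have hεanti : Antitone ε := antitone_nat_of_succ_le fun n => by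
    have := hε n
    have := hε0 n
    linarith
  have hF : Monotone F := monotone_nat_of_le_succ fun n => by
    rw [hFs]
    exact Finset.subset_union_left.trans Finset.subset_union_right
  let Y : Set SeqTree := ⋃ n, (F n : Set SeqTree)
  have hYc : Y.Countable := countable_iUnion fun n => (F n).countable_toSet
  have hYk : ∀ t ∈ Y, ∀ s, kids t s ∈ Y := by
    intro t ht s
    obtain ⟨m, hm⟩ := mem_iUnion.1 ht
    let n := max m (Nat.pair s.1 s.2)
    refine mem_iUnion.2 ⟨n + 1, ?_⟩
    have h1 : t ∈ F n := hF (le_max_left _ _) hm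
    have h2 : Nat.pair s.1 s.2 ∈ Finset.range (n + 1) :=
      Finset.mem_range.2 (Nat.lt_succ_of_le (le_max_right _ _))
    rw [hFs]
    refine Finset.mem_union_right _ (Finset.mem_union_right _ (Finset.mem_image.2
      ⟨(t, Nat.pair s.1 s.2), Finset.mem_product.2 ⟨h1, h2⟩, ?_⟩))
    simp
  let r : SeqTree → ℕ := fun z => sInf {n | z ∈ F n}
  have hr1 : ∀ z n, z ∈ F n → r z ≤ n := fun z n h => Nat.sInf_le h
  have hr2 : ∀ z ∈ Y, z ∈ F (r z) := fun z hz => Nat.sInf_mem (mem_iUnion.1 hz)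
  have := hYc.to_subtype
  obtain ⟨U, hU, hUd⟩ := exists_disjoint_images_ultra (Subtype.val : Y → SeqTree)
    Subtype.val_injective fun y => kids y.1
  -- A parent must enter strictly earlier, so that ranks decrease; restricting to `U` makes it
  -- unique.
  let P : SeqTree → SeqTree → Prop := fun z y =>
    ∃ hy : y ∈ Y, z ∉ F (r y) ∧ z ∈ Y ∧ z ∈ kids y '' U ⟨y, hy⟩
  have huniq : ∀ z y y', P z y → P z y' → y = y' := by
    rintro z y y' ⟨hy, -, -, h⟩ ⟨hy', -, -, h'⟩
    by_contra hne
    exact Set.disjoint_left.1 (hUd ⟨y, hy⟩ ⟨y', hy'⟩ fun h => hne (congrArg Subtype.val h)) h h'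
  have hdec : ∀ z y, P z y → r y < r z := by
    rintro z y ⟨hy, h, hz, -⟩
    by_contra hc
    exact h (hF (not_lt.1 hc) (hr2 z hz))
  have hPF : ∀ z y n, P z y → z ∈ (F (n + 1) : Set SeqTree) → y ∈ (F n : Set SeqTree) := by
    intro z y n hP hz
    have h1 := hdec z y hP
    have h2 := hr1 z (n + 1) hz
    exact hF (by omega) (hr2 y hP.1)
  obtain ⟨A, hAinf, hA⟩ := exists_negligible_stages F hF hYc
  obtain ⟨φ, hφ0, hφA, hφP⟩ := exists_limit_of_steps (fun n => (F n : Set SeqTree))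
    (fun m n h => Finset.coe_subset.2 (hF h)) ε hε hε0 r P huniq hdec hPF
    (fun n => st n (F n) (σ n).2) (fun n v z hz => hst n (F n) (σ n).2 v z hz) A v
  have hεlim : Tendsto ε atTop (𝓝 0) := by
    have hle : ∀ n, ε n ≤ ε 0 * (1 / 2) ^ n := by
      intro n
      induction n with
      | zero => simp
      | succ n ih => have := hε n; rw [pow_succ]; linarith
    refine squeeze_zero (fun n => (hε0 n).le) hle ?_
    simpa using (tendsto_pow_atTop_nhds_zero_of_lt_one (r := (1 / 2 : ℝ)) (by norm_num)
      (by norm_num)).const_mul (ε 0)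
  have hcoh : ∀ t ∈ Y, Function.Injective (kids t) →
      Tendsto (fun s => φ (kids t s)) (ultra t) (𝓝 (φ t)) := by
    intro t ht hinj
    refine Metric.tendsto_nhds.2 fun η hη => ?_
    obtain ⟨n, hn⟩ := (hεlim.eventually (gt_mem_nhds (show (0 : ℝ) < η / 4 by positivity))).exists
    have h1 : ∀ᶠ s in (ultra t : Filter (ℕ × ℕ)), kids t s ∉ F (max n (r t)) :=
      ultra_le_cofinite t ((F (max n (r t))).finite_toSet.preimage hinj.injOn).compl_mem_cofinite
    have h2 := Ultrafilter.compl_mem_iff_notMem.2 (hA t ht hinj)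
    -- Almost every child enters late, at a stage outside `A`, with `t` as its parent.
    filter_upwards [h1, h2, hU ⟨t, ht⟩ hinj] with s hs1 hs2 hs3
    have hz := hYk t ht s
    have hlt : max n (r t) < r (kids t s) := by
      by_contra hc
      exact hs1 (hF (not_lt.1 hc) (hr2 _ hz))
    obtain ⟨m, hm⟩ : ∃ m, r (kids t s) = m + 1 := ⟨r (kids t s) - 1, by omega⟩
    have hm1 : kids t s ∈ F (m + 1) := hm ▸ hr2 _ hz
    have hm2 : kids t s ∉ F m := fun h => by have := hr1 _ m h; omega
    have hmA : m ∉ A := fun h => hs2 ⟨m, h, hm1, hm2⟩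
    have hP : P (kids t s) t := ⟨ht, fun h => hs1 (hF (le_max_right _ _) h), hz, s, hs3, rfl⟩
    have h4 := hφP _ _ m hP hm1 hm2 hmA
    have h5 : ε (m + 1) ≤ ε n := hεanti (show n ≤ m + 1 by omega)
    linarith
  obtain ⟨ψ, hψ, hψY⟩ := exists_coherent_extension hYk φ hcoh
  have hFY : ∀ n, ∀ z ∈ F n, ψ z = φ z := fun n z hz => hψY z (mem_iUnion.2 ⟨n, hz⟩)
  refine ⟨ψ, hψ, fun n => ?_, fun x hx => ?_⟩
  -- Only stages in `A` enter a set `G m`; as `G` decreases, any of them beyond `n` will do.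
  · obtain ⟨m, hm, hnm⟩ := hAinf.exists_gt n
    obtain ⟨u, hu⟩ := hφA m hm
    refine hanti hnm.le (hstG m (F m) (σ m).2 u ψ hψ fun x hx => ?_)
    have hx' : x ∈ F (m + 1) := by rw [hFs]; exact Finset.mem_union_left _ hx
    rw [hFY (m + 1) x hx']
    have h1 := hu x hx'
    have h2 : ε (m + 1) ≤ δ m (F m) (σ m).2 / 2 := (hεs m).trans_le (min_le_right _ _)
    linarith
  · rw [hFY 0 x hx]
    have h1 := hφ0 x hx
    have h2 : ε 0 = ε₀ / 2 := rfl
    linarith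

/-- The coherent functions are dense among all functions. -/
theorem exists_coherent_near (v : SeqTree → unitInterval) (F : Finset SeqTree) {ε : ℝ}
    (hε : 0 < ε) : ∃ φ, Coherent φ ∧ ∀ x ∈ F, dist (φ x) (v x) ≤ ε := by
  obtain ⟨φ, h1, -, h2⟩ := exists_coherent_of_robust (fun _ => univ) antitone_const
    (fun _ _ ε => ⟨∅, ε, fun v => ⟨v, fun x _ => by simpa using ε.2.le, fun _ _ _ => mem_univ _⟩⟩)
    v F hε
  exact ⟨φ, h1, h2⟩

/-! ### The topology of the space -/

/-- The weak topology of the coherent functions. -/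
instance : TopologicalSpace SeqTree :=
  ⨅ φ : {φ : SeqTree → unitInterval // Coherent φ}, TopologicalSpace.induced φ.1 inferInstance

theorem Coherent.continuous {φ : SeqTree → unitInterval} (h : Coherent φ) : Continuous φ :=
  continuous_iInf_dom (i := (⟨φ, h⟩ : {φ : SeqTree → unitInterval // Coherent φ}))
    continuous_induced_dom

theorem tendsto_kids {t : SeqTree} (ht : Function.Injective (kids t)) :
    Tendsto (kids t) (ultra t) (𝓝 t) := by
  rw [nhds_iInf, tendsto_iInf]
  intro φ
  rw [nhds_induced, tendsto_comap_iff]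
  exact φ.2 t ht

theorem continuous_iff_coherent {φ : SeqTree → unitInterval} : Continuous φ ↔ Coherent φ :=
  ⟨fun h t ht => (h.tendsto t).comp (tendsto_kids ht), Coherent.continuous⟩

instance : Infinite SeqTree := Infinite.of_injective leaf fun _ _ h => leaf.inj h

instance : T35Space SeqTree where
  t0 := by
    classical
    intro x y hxy
    by_contra hne
    obtain ⟨φ, hφ, h⟩ := exists_coherent_near (fun z => if z = x then 1 else 0) {x, y}
      (show (0 : ℝ) < 1 / 3 by norm_num)
    have h1 := h x (by simp)
    have h2 := h y (by simp)
    have h3 : φ x = φ y := (hxy.map hφ.continuous).eq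
    rw [if_pos rfl, h3] at h1
    rw [if_neg (Ne.symm hne)] at h2
    have h4 := dist_triangle_left (1 : unitInterval) 0 (φ y)
    rw [Subtype.dist_eq] at h4
    simp at h4
    linarith
  completely_regular := (completelyRegularSpace_iInf fun _ =>
    completelyRegularSpace_induced inferInstance _).completely_regular

instance : CountablyCompactSpace SeqTree := by
  refine ⟨isCountablyCompact_iff_infinite_subset_has_accPt.2 fun B _ hB => ?_⟩
  let f : ℕ × ℕ → SeqTree := fun s => hB.natEmbedding B (Nat.pair s.1 s.2)
  have hf : Function.Injective f := fun s s' h => by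
    have h := (hB.natEmbedding B).injective (Subtype.ext h)
    exact Prod.ext (Nat.pair_eq_pair.1 h).1 (Nat.pair_eq_pair.1 h).2
  refine ⟨lim f, mem_univ _, accPt_iff_frequently.2 ?_⟩
  refine (tendsto_kids (t := lim f) hf).frequently (Eventually.frequently ?_)
  have h : ∀ᶠ s in (ultra (lim f) : Filter (ℕ × ℕ)), f s ≠ lim f :=
    ultra_le_cofinite _ ((finite_singleton (lim f)).preimage hf.injOn).compl_mem_cofinite
  filter_upwards [h] with s hs
  exact ⟨hs, (hB.natEmbedding B (Nat.pair s.1 s.2)).2⟩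

end SeqTree

/-! ### The Baire property -/

theorem Finset.exists_pos_le {ι : Type*} (s : Finset ι) (d : ι → ℝ) (hd : ∀ i ∈ s, 0 < d i) :
    ∃ δ > 0, ∀ i ∈ s, δ ≤ d i := by
  have h : ∀ᶠ δ in 𝓝[>] (0 : ℝ), ∀ i ∈ s, δ ≤ d i :=
    (Finset.eventually_all s).2 fun i hi => nhdsWithin_le_nhds (Iic_mem_nhds (hd i hi))
  obtain ⟨δ, h1, h2⟩ := (h.and self_mem_nhdsWithin).exists
  exact ⟨δ, h2, h1⟩

theorem Cp.exists_finset_subset_of_isOpen {X Z : Type*} [TopologicalSpace X] [MetricSpace Z]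
    {D : Set (Cp X Z)} (hD : IsOpen D) {g : Cp X Z} (hg : g ∈ D) :
    ∃ F : Finset X, ∃ δ > 0, ∀ g' : Cp X Z, (∀ x ∈ F, dist (g'.1 x) (g.1 x) ≤ δ) → g' ∈ D := by
  obtain ⟨V, hV, rfl⟩ := isOpen_induced_iff.1 hD
  obtain ⟨F, u, hu, hFu⟩ := isOpen_pi_iff.1 hV g.1 hg
  have : ∀ x, ∃ d > 0, x ∈ F → Metric.closedBall (g.1 x) d ⊆ u x := by
    intro x
    by_cases hx : x ∈ F
    · obtain ⟨d, h1, h2⟩ := Metric.nhds_basis_closedBall.mem_iff.1 ((hu x hx).1.mem_nhds (hu x hx).2)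
      exact ⟨d, h1, fun _ => h2⟩
    · exact ⟨1, one_pos, fun h => absurd h hx⟩
  choose d hd hdu using this
  obtain ⟨δ, hδ, hδd⟩ := F.exists_pos_le d fun x _ => hd x
  exact ⟨F, δ, hδ, fun g' h => hFu fun x hx => hdu x hx ((h x hx).trans (hδd x hx))⟩

namespace SeqTree

/-- By compactness of `[0,1]^F`, finitely many members of `D` approximate all data on `F`, so `F'`
and `δ` can be chosen independently of `v`. -/
theorem exists_robust_extension {D : Set (Cp SeqTree unitInterval)} (hDo : IsOpen D)
    (hDd : Dense D) (F : Finset SeqTree) {ε : ℝ} (hε : 0 < ε) :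
    ∃ F' : Finset SeqTree, ∃ δ > 0, ∀ v : SeqTree → unitInterval,
      ∃ h : SeqTree → unitInterval, (∀ x ∈ F, dist (h x) (v x) ≤ ε) ∧
        ∀ g : Cp SeqTree unitInterval, (∀ x ∈ F', dist (g.1 x) (h x) ≤ δ) → g ∈ D := by
  classical
  have hstep : ∀ w : F → unitInterval, ∃ g ∈ D, ∀ x : F, dist (g.1 x) (w x) ≤ ε / 2 := by
    intro w
    obtain ⟨φ, hφ, hφw⟩ := exists_coherent_near (fun z => if h : z ∈ F then w ⟨z, h⟩ else 0) F
      (show 0 < ε / 4 by positivity)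
    let φ' : Cp SeqTree unitInterval := ⟨φ, hφ.continuous⟩
    have hev : ∀ᶠ g in 𝓝 φ', ∀ x ∈ F, dist (g.1 x) (φ x) < ε / 4 := by
      refine (Finset.eventually_all F).2 fun x _ => ?_
      have hc : Continuous fun g : Cp SeqTree unitInterval => dist (g.1 x) (φ x) :=
        ((continuous_apply x).comp continuous_subtype_val).dist continuous_const
      refine hc.continuousAt.eventually (gt_mem_nhds ?_)
      simpa [φ'] using hε
    obtain ⟨g, hg1, hg2⟩ := hDd.inter_nhds_nonempty hev
    refine ⟨g, hg1, fun x => ?_⟩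
    have h1 := hg2 x x.2
    have h2 := hφw x x.2
    rw [dif_pos x.2] at h2
    have h3 := dist_triangle (g.1 x) (φ x) (w x)
    linarith
  choose g hgD hg using hstep
  choose F' δ hδ hF' using fun w => Cp.exists_finset_subset_of_isOpen hDo (hgD w)
  obtain ⟨T, hT⟩ := isCompact_univ.elim_nhds_subcover
    (fun w : F → unitInterval => Metric.ball w (ε / 2))
    fun w _ => Metric.ball_mem_nhds w (half_pos hε)
  obtain ⟨δ₀, hδ₀, hδT⟩ := T.exists_pos_le δ fun w _ => hδ w
  refine ⟨T.biUnion F', δ₀, hδ₀, fun v => ?_⟩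
  obtain ⟨w, hw, hvw⟩ := mem_iUnion₂.1 (hT.2 (mem_univ fun x : F => v x))
  refine ⟨(g w).1, fun x hx => ?_, fun f hf => hF' w f fun x hx => ?_⟩
  · have h1 := hg w ⟨x, hx⟩
    have h2 := dist_le_pi_dist (fun x : F => v x) w ⟨x, hx⟩
    have h3 := Metric.mem_ball.1 hvw
    have h4 := dist_triangle_right ((g w).1 x) (v x) (w ⟨x, hx⟩)
    dsimp only at h1 h2
    linarith
  · exact (hf x (Finset.mem_biUnion.2 ⟨w, hw, hx⟩)).trans (hδT w hw)

instance : BaireSpace (Cp SeqTree unitInterval) where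
  baire_property := by
    intro G hGo hGd
    let D : ℕ → Set (Cp SeqTree unitInterval) := fun n => ⋂ m ∈ Finset.range (n + 1), G m
    have hD : ∀ n, IsOpen (⋂ m ∈ Finset.range n, G m) ∧ Dense (⋂ m ∈ Finset.range n, G m) := by
      intro n
      induction n with
      | zero => simp
      | succ n ih =>
        rw [Finset.range_add_one, Finset.set_biInter_insert]
        exact ⟨(hGo n).inter ih.1, (hGd n).inter_of_isOpen_left ih.2 (hGo n)⟩
    refine dense_iff_inter_open.2 fun O hO hne => ?_
    obtain ⟨g₀, hg₀⟩ := hne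
    obtain ⟨F₀, ε₀, hε₀, hF₀⟩ := Cp.exists_finset_subset_of_isOpen hO hg₀
    obtain ⟨φ, hφ, hφD, hφ0⟩ := exists_coherent_of_robust
      (fun n => {g | ∀ hg : Continuous g, (⟨g, hg⟩ : Cp SeqTree unitInterval) ∈ D n})
      (fun m n hmn g hg hgc => biInter_mono (Finset.range_mono (Nat.succ_le_succ hmn))
        (fun _ _ => Subset.rfl) (hg hgc))
      (fun n F ε => by
        obtain ⟨F', δ, hδ, h⟩ := exists_robust_extension (hD (n + 1)).1 (hD (n + 1)).2 F ε.2
        refine ⟨F', ⟨δ, hδ⟩, fun v => ?_⟩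
        obtain ⟨h', h1, h2⟩ := h v
        exact ⟨h', h1, fun g _ hg hgc => h2 ⟨g, hgc⟩ hg⟩)
      g₀.1 F₀ hε₀
    refine ⟨⟨φ, hφ.continuous⟩, hF₀ _ hφ0, mem_iInter.2 fun n => ?_⟩
    exact mem_iInter₂.1 (hφD n hφ.continuous) n (Finset.self_mem_range_succ n)

end SeqTree

theorem mainTheorem7 :
    ∃ (X : Type) (_ : TopologicalSpace X),
      Infinite X ∧ T35Space X ∧ CountablyCompactSpace X ∧ BaireSpace (Cp X unitInterval) :=
  ⟨SeqTree, inferInstance, inferInstance, inferInstance, inferInstance, inferInstance⟩
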